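/- **Theorem 3.** For every constant $c'>0$ there is a constant $c>0$, depending only on $c'$, such that the following holds. Consider the linear regression model $Y=X\theta^*+W$, where $X$ is a deterministic $n\times M$ real matrix with $M\ge 2$, $\theta^*\in\mathbb{R}^M$, and $W=(W_1,\dots,W_n)^T$ has independent components with $\mathbb{E}[W_i]=0$ and $\mathbb{E}[W_i^2]\le\sigma^2$, $i=1,\dots,n$, for some $\sigma>0$. Let $\delta>0$ and $$r=\sigma\sqrt{\frac{(\log M)^{1+\delta}}{n}} .$$ Let $\hat\Theta^L$ be the set of all Lasso solutions, i.e. of all minimizers over $\theta\in\mathbb{R}^M$ of $\frac1n|Y-X\theta|_2^2+2r|\theta|_1$, and let $\hat\Theta^D$ be the set of all Dantzig solutions, i.e. of all minimizers of $|\theta|_1$ over those $\theta\in\mathbb{R}^M$ for which $\left|\frac1nX^T(Y-X\theta)\right|_\infty\le r$. For $c_0\ge 0$ and $\alpha>1$ put $$c_2(c_0,\alpha)=\frac32\left(1+\frac{(1+c_0)^2}{(1+2c_0)(\alpha-1)}\right).$$ Let $s\ge1$ be an integer and $\alpha>1$. Assume that $\theta^*$ has at most $s$ non-zero components, that $$\frac1n\sum_{i=1}^n\max_{1\le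 j\le M}|X_{i,j}|^2\le c',$$ and that the Gram matrix $\Psi=\frac1nX^TX$ satisfies $$\Psi_{j,j}=1\ \ (1\le j\le M),\qquad \max_{i\ne j}|\Psi_{i,j}|\le\frac{1}{\alpha(1+2c_0)s},$$ where $c_0=1$ or $c_0=3$. (a) If $c_0=1$, then $$\mathbb{P}\left(\sup_{\hat\theta\in\hat\Theta^D}|\hat\theta-\theta^*|_\infty\le c_2(1,\alpha)\,r\right)\ge1-\frac{c}{(\log M)^\delta}.$$ (b) If $c_0=3$, then, with probability at least $1-\frac{c}{(\log M)^\delta}$, simultaneously $$\sup_{\hat\theta\in\hat\Theta^L}|\hat\theta-\theta^*|_\infty\le c_2(3,\alpha)\,r\qquad\text{and}\qquad\sup_{\hat\theta\in\hat\Theta^D}|\hat\theta-\theta^*|_\infty\le c_2(1,\alpha)\,r.$$ -/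

import Mathlib

open MeasureTheory ProbabilityTheory
open scoped Matrix

noncomputable section

/-- The Lasso objective `Φ(θ) = (1/n) |y - Xθ|₂² + 2 r |θ|₁`. -/
def lassoObjective {n M : ℕ} (X : Matrix (Fin n) (Fin M) ℝ) (r : ℝ) (y : Fin n → ℝ)
    (θ : Fin M → ℝ) : ℝ :=
  (1 / (n : ℝ)) * ∑ i, (y i - (X *ᵥ θ) i) ^ 2 + 2 * r * ∑ j, |θ j|

/-- The set of all Lasso estimators: all global minimizers of the Lasso objective. -/
def lassoSolutions {n M : ℕ} (X : Matrix (Fin n) (Fin M) ℝ) (r : ℝ) (y : Fin n → ℝ) :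
    Set (Fin M → ℝ) :=
  {θ | IsMinOn (lassoObjective X r y) Set.univ θ}

/-- The Dantzig constraint set `{θ : |(1/n) Xᵀ (y - Xθ)|_∞ ≤ r}`. -/
def dantzigFeasible {n M : ℕ} (X : Matrix (Fin n) (Fin M) ℝ) (r : ℝ) (y : Fin n → ℝ) :
    Set (Fin M → ℝ) :=
  {θ | ∀ j, |(1 / (n : ℝ)) * (Xᵀ *ᵥ (y - X *ᵥ θ)) j| ≤ r}

/-- The set of all Dantzig estimators: all minimizers of `|θ|₁` over the Dantzig constraint set. -/
def dantzigSolutions {n M : ℕ} (X : Matrix (Fin n) (Fin M) ℝ) (r : ℝ) (y : Fin n → ℝ) :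
    Set (Fin M → ℝ) :=
  {θ | θ ∈ dantzigFeasible X r y ∧
    IsMinOn (fun θ' : Fin M → ℝ => ∑ j, |θ' j|) (dantzigFeasible X r y) θ}

/-- The Gram matrix `Ψ = (1/n) Xᵀ X`. -/
def gramMatrix {n M : ℕ} (X : Matrix (Fin n) (Fin M) ℝ) : Matrix (Fin M) (Fin M) ℝ :=
  (1 / (n : ℝ)) • (Xᵀ * X)

/-- The mutual coherence assumption: the Gram matrix has unit diagonal, and its off-diagonal
entries are at most `1 / (α (1 + 2 c₀) s)` in absolute value. -/
structure MutualCoherence {n M : ℕ} (X : Matrix (Fin n) (Fin M) ℝ) (c₀ α : ℝ) (s : ℕ) :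
    Prop where
  diag : ∀ j, gramMatrix X j j = 1
  offDiag : ∀ i j, i ≠ j → |gramMatrix X i j| ≤ 1 / (α * (1 + 2 * c₀) * s)

/-- The number `M(θ) = |{j : θ_j ≠ 0}|` of non-zero components of `θ`. -/
def numNonzero {M : ℕ} (θ : Fin M → ℝ) : ℕ := {j | θ j ≠ 0}.ncard

/-- The constant `c₂ = (3/2) (1 + (1 + c₀)² / ((1 + 2 c₀) (α - 1)))`. -/
def rateConst (c₀ α : ℝ) : ℝ :=
  3 / 2 * (1 + (1 + c₀) ^ 2 / ((1 + 2 * c₀) * (α - 1)))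

/-- The tuning parameter `r = σ √((log M)^{1+δ} / n)`. -/
def tuning (n M : ℕ) (σ δ : ℝ) : ℝ :=
  σ * Real.sqrt (Real.log M ^ (1 + δ) / n)

end

/-! The estimate is deterministic once the noise satisfies `|(1/n) Xᵀ W|_∞ ≤ r / 2`. Put `Δ = θ̂ -
θ*`. Every Dantzig or Lasso solution has residual correlations at most `r`, so `|ΨΔ|_∞ ≤ r / 2 + r`.
Minimality puts `Δ` in the cone `|Δ_{Jᶜ}|₁ ≤ c₀ |Δ_J|₁`, with `J` the support of `θ*` and `c₀ = 1`
(Dantzig) or `c₀ = 3` (Lasso). On this cone small coherence makes `Ψ` invertible in sup-norm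
(`abs_le_of_coherence`), which gives `rateConst`. One noise event serves both estimators.

With only two moments, a union bound over columns would lose a power of `M`. Instead `logSumExp`
serves as a smooth maximum whose second-order error is at most `2 ‖h‖²` in sup-norm, whatever the
dimension. When independent centred vectors are added one at a time, the first-order terms integrate
to zero, so the first two moments grow only with `∑ E‖ξ i‖²` (`integral_logSumExp_sum_le`).
Rescaling until this sum is at most `log M`, Chebyshev on the second moment gives failure
probability `O((log M)^(-δ))`. -/

/-! ### Smoothness of log-sum-exp in the sup-norm -/

section LogSumExp

variable {κ : Type*} [Fintype κ]

/-- The function `x ↦ log ∑ⱼ exp xⱼ`, a smooth upper bound of the maximum of the coordinates. -/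
noncomputable def logSumExp (x : κ → ℝ) : ℝ := Real.log (∑ j, Real.exp (x j))

/-- The gradient of `logSumExp`. -/
noncomputable def softmax (x : κ → ℝ) (j : κ) : ℝ := Real.exp (x j) / ∑ k, Real.exp (x k)

lemma sum_exp_pos [Nonempty κ] (x : κ → ℝ) : 0 < ∑ j, Real.exp (x j) :=
  Finset.sum_pos (fun _ _ => Real.exp_pos _) Finset.univ_nonempty

lemma softmax_nonneg (x : κ → ℝ) (j : κ) : 0 ≤ softmax x j := by
  unfold softmax; positivity

lemma sum_softmax [Nonempty κ] (x : κ → ℝ) : ∑ j, softmax x j = 1 := by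
  unfold softmax
  rw [← Finset.sum_div, div_self (sum_exp_pos x).ne']

lemma le_logSumExp [Nonempty κ] (x : κ → ℝ) (j : κ) : x j ≤ logSumExp x := by
  unfold logSumExp
  rw [Real.le_log_iff_exp_le (sum_exp_pos x)]
  exact Finset.single_le_sum (f := fun j => Real.exp (x j)) (fun k _ => (Real.exp_pos _).le)
    (Finset.mem_univ j)

lemma logSumExp_zero : logSumExp (0 : κ → ℝ) = Real.log (Fintype.card κ) := by
  simp [logSumExp]

lemma logSumExp_add_le [Nonempty κ] (x h : κ → ℝ) {U : ℝ} (hU : ∀ j, h j ≤ U) :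
    logSumExp (x + h) ≤ logSumExp x + U := by
  unfold logSumExp
  rw [Real.log_le_iff_le_exp (sum_exp_pos _), Real.exp_add, Real.exp_log (sum_exp_pos x),
    Finset.sum_mul]
  refine Finset.sum_le_sum fun j _ => ?_
  rw [← Real.exp_add]
  exact Real.exp_le_exp.2 (by simpa using hU j)

lemma abs_logSumExp_add_sub_le [Nonempty κ] (x h : κ → ℝ) {U : ℝ} (hU : ∀ j, |h j| ≤ U) :
    |logSumExp (x + h) - logSumExp x| ≤ U := by
  have h1 := logSumExp_add_le x h fun j => (abs_le.1 (hU j)).2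
  have h2 := logSumExp_add_le (x + h) (-h) (U := U) fun j => by
    have := (abs_le.1 (hU j)).1
    simp only [Pi.neg_apply]; linarith
  rw [add_neg_cancel_right] at h2
  exact abs_le.2 ⟨by linarith, by linarith⟩

lemma abs_sum_softmax_mul_le [Nonempty κ] (x h : κ → ℝ) {U : ℝ} (hU : ∀ j, |h j| ≤ U) :
    |∑ j, softmax x j * h j| ≤ U := by
  calc |∑ j, softmax x j * h j| ≤ ∑ j, |softmax x j * h j| := Finset.abs_sum_le_sum_abs _ _
    _ ≤ ∑ j, softmax x j * U := Finset.sum_le_sum fun j _ => by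
        rw [abs_mul, abs_of_nonneg (softmax_nonneg x j)]
        exact mul_le_mul_of_nonneg_left (hU j) (softmax_nonneg x j)
    _ = U := by rw [← Finset.sum_mul, sum_softmax, one_mul]

/-- `logSumExp` is smooth with respect to the sup-norm, with a constant free of dimension. -/
lemma logSumExp_add_le_smooth [Nonempty κ] (x h : κ → ℝ) {U : ℝ} (hU : ∀ j, |h j| ≤ U) :
    logSumExp (x + h) ≤ logSumExp x + ∑ j, softmax x j * h j + 2 * U ^ 2 := by
  -- The bound `|exp h - 1 - h| ≤ h²` needs `|h| ≤ 1`. For `U > 1` the Lipschitz bound is enough,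
  -- since `2 * U ≤ 2 * U ^ 2`; this case is what uses the factor 2.
  rcases le_or_gt U 1 with hU1 | hU1
  · have hZ := sum_exp_pos x
    have hZ' := sum_exp_pos (x + h)
    have key : (∑ j, Real.exp ((x + h) j)) / (∑ j, Real.exp (x j)) ≤
        1 + ∑ j, softmax x j * h j + U ^ 2 := by
      calc (∑ j, Real.exp ((x + h) j)) / (∑ j, Real.exp (x j))
          = ∑ j, softmax x j * Real.exp (h j) := by
            rw [Finset.sum_div]
            refine Finset.sum_congr rfl fun j _ => ?_
            rw [softmax, Pi.add_apply, Real.exp_add]; ring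
        _ ≤ ∑ j, softmax x j * (1 + h j + U ^ 2) := by
            refine Finset.sum_le_sum fun j _ =>
              mul_le_mul_of_nonneg_left ?_ (softmax_nonneg x j)
            have h1 := (abs_le.1 (Real.abs_exp_sub_one_sub_id_le ((hU j).trans hU1))).2
            have h2 : h j ^ 2 ≤ U ^ 2 := sq_le_sq' (abs_le.1 (hU j)).1 (abs_le.1 (hU j)).2
            linarith
        _ = 1 + ∑ j, softmax x j * h j + U ^ 2 := by
            simp only [mul_add, Finset.sum_add_distrib, ← Finset.sum_mul, sum_softmax]
            ring
    have hlog := Real.log_le_sub_one_of_pos (div_pos hZ' hZ)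
    rw [Real.log_div hZ'.ne' hZ.ne'] at hlog
    unfold logSumExp
    nlinarith [sq_nonneg U]
  · have h1 := logSumExp_add_le x h fun j => (abs_le.1 (hU j)).2
    have h2 := (abs_le.1 (abs_sum_softmax_mul_le x h hU)).1
    nlinarith

/-- Write the increment as `d` and expand `(L + d)²`: smoothness bounds `2 L d`, the Lipschitz bound
gives `d² ≤ U²`. The one-sided smoothness bound may be multiplied by `L` only because `0 ≤ L`. -/
lemma logSumExp_add_sq_le [Nonempty κ] (x h : κ → ℝ) {U : ℝ} (hU : ∀ j, |h j| ≤ U)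
    (hx : 0 ≤ logSumExp x) :
    logSumExp (x + h) ^ 2 ≤ logSumExp x ^ 2 + 2 * (logSumExp x * ∑ j, softmax x j * h j) +
      U ^ 2 * (1 + 4 * logSumExp x) := by
  have h1 := logSumExp_add_le_smooth x h hU
  have h2 := abs_logSumExp_add_sub_le x h hU
  have h3 : (logSumExp (x + h) - logSumExp x) ^ 2 ≤ U ^ 2 :=
    sq_le_sq' (abs_le.1 h2).1 (abs_le.1 h2).2
  nlinarith [mul_le_mul_of_nonneg_left h1 hx]

lemma measurable_logSumExp : Measurable (logSumExp : (κ → ℝ) → ℝ) := by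
  unfold logSumExp; fun_prop

lemma measurable_softmax (j : κ) : Measurable fun x : κ → ℝ => softmax x j := by
  unfold softmax; fun_prop

lemma abs_logSumExp_le [Nonempty κ] (x : κ → ℝ) :
    |logSumExp x| ≤ Real.log (Fintype.card κ) + ‖x‖ := by
  have h := abs_logSumExp_add_sub_le 0 x fun j => norm_le_pi_norm x j
  rw [zero_add, logSumExp_zero] at h
  have hc : 0 ≤ Real.log (Fintype.card κ) := Real.log_natCast_nonneg _
  rw [abs_le] at h ⊢
  constructor <;> linarith

end LogSumExp

/-! ### Moments of log-sum-exp of independent centred sums -/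

section Moments

variable {Ω κ ι : Type*} [MeasurableSpace Ω] {μ : Measure Ω} [Fintype κ]

lemma memLp_eval {ξ : Ω → κ → ℝ} (hξ : MemLp ξ 2 μ) (j : κ) : MemLp (fun ω => ξ ω j) 2 μ :=
  hξ.of_le ((measurable_pi_apply j).comp_aemeasurable hξ.1.aemeasurable).aestronglyMeasurable
    (ae_of_all _ fun ω => norm_le_pi_norm (ξ ω) j)

variable [IsProbabilityMeasure μ] [Nonempty κ]

lemma memLp_logSumExp {S : Ω → κ → ℝ} (hS : MemLp S 2 μ) :
    MemLp (fun ω => logSumExp (S ω)) 2 μ := by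
  have hb : MemLp (fun ω => Real.log (Fintype.card κ) + ‖S ω‖) 2 μ :=
    (memLp_const (Real.log (Fintype.card κ))).add hS.norm
  refine hb.mono' ?_ (ae_of_all _ fun ω => abs_logSumExp_le _)
  exact (measurable_logSumExp.comp_aemeasurable hS.1.aemeasurable).aestronglyMeasurable

/-- A centred vector is uncorrelated with an independent one, through the gradient of
`logSumExp`. -/
lemma integral_mul_sum_softmax_mul_eq_zero {S ξ : Ω → κ → ℝ} {g : (κ → ℝ) → ℝ}
    (hg : Measurable g) (hind : S ⟂ᵢ[μ] ξ) (hSm : Measurable S) (hξ : MemLp ξ 2 μ)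
    (hgS : MemLp (fun ω => g (S ω)) 2 μ) (h0 : ∀ j, ∫ ω, ξ ω j ∂μ = 0) :
    Integrable (fun ω => g (S ω) * ∑ j, softmax (S ω) j * ξ ω j) μ ∧
      ∫ ω, g (S ω) * ∑ j, softmax (S ω) j * ξ ω j ∂μ = 0 := by
  have hφ : ∀ j, Measurable fun x : κ → ℝ => g x * softmax x j := fun j =>
    hg.mul (measurable_softmax j)
  have hφS : ∀ j, Integrable (fun ω => g (S ω) * softmax (S ω) j) μ := fun j => by
    refine (hgS.integrable (by norm_num)).norm.mono'
      ((hφ j).comp hSm).aestronglyMeasurable (ae_of_all _ fun ω => ?_)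
    have hle : softmax (S ω) j ≤ 1 := by
      rw [← sum_softmax (S ω)]
      exact Finset.single_le_sum (fun k _ => softmax_nonneg (S ω) k) (Finset.mem_univ j)
    rw [norm_mul, Real.norm_of_nonneg (softmax_nonneg _ j)]
    exact mul_le_of_le_one_right (norm_nonneg _) hle
  have hind' : ∀ j, (fun ω => g (S ω) * softmax (S ω) j) ⟂ᵢ[μ] (fun ω => ξ ω j) := fun j =>
    hind.comp (hφ j) (measurable_pi_apply j)
  have hξi : ∀ j, Integrable (fun ω => ξ ω j) μ := fun j =>
    (memLp_eval hξ j).integrable (by norm_num)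
  have hint : ∀ j, Integrable (fun ω => g (S ω) * softmax (S ω) j * ξ ω j) μ := fun j =>
    (hind' j).integrable_mul (hφS j) (hξi j)
  have heq : (fun ω => g (S ω) * ∑ j, softmax (S ω) j * ξ ω j) =
      fun ω => ∑ j, g (S ω) * softmax (S ω) j * ξ ω j := by
    funext ω
    rw [Finset.mul_sum]
    exact Finset.sum_congr rfl fun j _ => (mul_assoc _ _ _).symm
  rw [heq]
  refine ⟨integrable_finsetSum _ fun j _ => hint j, ?_⟩
  rw [integral_finsetSum _ fun j _ => hint j]
  refine Finset.sum_eq_zero fun j _ => ?_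
  rw [(hind' j).integral_fun_mul_eq_mul_integral (hφS j).1 (hξi j).1, h0, mul_zero]

variable {S ξ : Ω → κ → ℝ}

lemma integral_logSumExp_add_le (hind : S ⟂ᵢ[μ] ξ) (hSm : Measurable S) (hS : MemLp S 2 μ)
    (hξ : MemLp ξ 2 μ) (h0 : ∀ j, ∫ ω, ξ ω j ∂μ = 0) :
    ∫ ω, logSumExp (S ω + ξ ω) ∂μ ≤
      ∫ ω, logSumExp (S ω) ∂μ + 2 * ∫ ω, ‖ξ ω‖ ^ 2 ∂μ := by
  obtain ⟨hi, hz⟩ := integral_mul_sum_softmax_mul_eq_zero (g := fun _ => 1) measurable_const hind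
    hSm hξ (memLp_const _) h0
  simp only [one_mul] at hi hz
  have hLS := (memLp_logSumExp hS).integrable one_le_two
  have hL' := (memLp_logSumExp (hS.add hξ)).integrable one_le_two
  have hn : Integrable (fun ω => 2 * ‖ξ ω‖ ^ 2) μ := hξ.norm.integrable_sq.const_mul 2
  have hs : Integrable (fun ω => logSumExp (S ω) + ∑ j, softmax (S ω) j * ξ ω j) μ := hLS.add hi
  calc ∫ ω, logSumExp (S ω + ξ ω) ∂μ
      ≤ ∫ ω, (logSumExp (S ω) + ∑ j, softmax (S ω) j * ξ ω j + 2 * ‖ξ ω‖ ^ 2) ∂μ :=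
        integral_mono hL' (hs.add hn) fun ω =>
          logSumExp_add_le_smooth _ _ fun j => norm_le_pi_norm (ξ ω) j
    _ = _ := by
        rw [integral_add hs hn, integral_add hLS hi, hz, integral_const_mul, add_zero]

/-- In the pointwise bound the linear term has mean zero, and the remainder is a product of a
function of `ξ` and a function of `S`, so its expectation factors. -/
lemma integral_logSumExp_add_sq_le (hind : S ⟂ᵢ[μ] ξ) (hSm : Measurable S) (hS : MemLp S 2 μ)
    (hξ : MemLp ξ 2 μ) (h0 : ∀ j, ∫ ω, ξ ω j ∂μ = 0) (hpos : ∀ ω, 0 ≤ logSumExp (S ω)) :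
    ∫ ω, logSumExp (S ω + ξ ω) ^ 2 ∂μ ≤ ∫ ω, logSumExp (S ω) ^ 2 ∂μ +
      (∫ ω, ‖ξ ω‖ ^ 2 ∂μ) * (1 + 4 * ∫ ω, logSumExp (S ω) ∂μ) := by
  have hLS2 := memLp_logSumExp hS
  have hLS := hLS2.integrable one_le_two
  obtain ⟨hi, hz⟩ := integral_mul_sum_softmax_mul_eq_zero measurable_logSumExp hind hSm hξ hLS2 h0
  have hn : Integrable (fun ω => ‖ξ ω‖ ^ 2) μ := hξ.norm.integrable_sq
  have hl : Integrable (fun ω => 1 + 4 * logSumExp (S ω)) μ :=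
    (integrable_const _).add (hLS.const_mul 4)
  have hind' : (fun ω => ‖ξ ω‖ ^ 2) ⟂ᵢ[μ] (fun ω => 1 + 4 * logSumExp (S ω)) :=
    hind.symm.comp (φ := fun x : κ → ℝ => ‖x‖ ^ 2) (ψ := fun x => 1 + 4 * logSumExp x)
      (measurable_norm.pow_const 2) ((measurable_logSumExp.const_mul 4).const_add 1)
  have hp : Integrable (fun ω => ‖ξ ω‖ ^ 2 * (1 + 4 * logSumExp (S ω))) μ :=
    hind'.integrable_mul hn hl
  have hs : Integrable (fun ω => logSumExp (S ω) ^ 2 +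
      2 * (logSumExp (S ω) * ∑ j, softmax (S ω) j * ξ ω j)) μ :=
    hLS2.integrable_sq.add (hi.const_mul 2)
  calc ∫ ω, logSumExp (S ω + ξ ω) ^ 2 ∂μ
      ≤ ∫ ω, (logSumExp (S ω) ^ 2 + 2 * (logSumExp (S ω) * ∑ j, softmax (S ω) j * ξ ω j) +
          ‖ξ ω‖ ^ 2 * (1 + 4 * logSumExp (S ω))) ∂μ :=
        integral_mono (memLp_logSumExp (hS.add hξ)).integrable_sq
          (hs.add hp) fun ω =>
          logSumExp_add_sq_le _ _ (fun j => norm_le_pi_norm (ξ ω) j) (hpos ω)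
    _ = _ := by
        rw [integral_add hs hp,
          integral_add hLS2.integrable_sq (hi.const_mul 2), integral_const_mul, hz,
          hind'.integral_fun_mul_eq_mul_integral hn.1 hl.1,
          integral_add (integrable_const _) (hLS.const_mul 4), integral_const_mul]
        simp

/-- First and second moment of `logSumExp` of a sum of independent centred vectors, in terms of the
second moments of their sup-norms. -/
lemma integral_logSumExp_sum_le {ξ : ι → Ω → κ → ℝ} (hm : ∀ i, Measurable (ξ i))
    (hind : iIndepFun ξ μ) (hξ : ∀ i, MemLp (ξ i) 2 μ) (h0 : ∀ i j, ∫ ω, ξ i ω j ∂μ = 0)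
    (hpos : ∀ (s : Finset ι) ω, 0 ≤ logSumExp (∑ i ∈ s, ξ i ω)) (s : Finset ι) :
    ∫ ω, logSumExp (∑ i ∈ s, ξ i ω) ∂μ ≤
        Real.log (Fintype.card κ) + 2 * ∑ i ∈ s, ∫ ω, ‖ξ i ω‖ ^ 2 ∂μ ∧
      ∫ ω, logSumExp (∑ i ∈ s, ξ i ω) ^ 2 ∂μ ≤ Real.log (Fintype.card κ) ^ 2 +
        (∑ i ∈ s, ∫ ω, ‖ξ i ω‖ ^ 2 ∂μ) *
          (1 + 4 * (Real.log (Fintype.card κ) + 2 * ∑ i ∈ s, ∫ ω, ‖ξ i ω‖ ^ 2 ∂μ)) := by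
  classical
  have hv : ∀ i, 0 ≤ ∫ ω, ‖ξ i ω‖ ^ 2 ∂μ := fun i => integral_nonneg fun ω => by positivity
  induction s using Finset.induction_on with
  | empty => simp [logSumExp_zero]
  | insert k s hk ih =>
    obtain ⟨ih1, ih2⟩ := ih
    have hmS : Measurable fun ω => ∑ i ∈ s, ξ i ω := Finset.measurable_fun_sum _ fun i _ => hm i
    have hS : MemLp (fun ω => ∑ i ∈ s, ξ i ω) 2 μ := memLp_finsetSum _ fun i _ => hξ i
    have hI : (fun ω => ∑ i ∈ s, ξ i ω) ⟂ᵢ[μ] ξ k := by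
      have := hind.indepFun_finsetSum_of_notMem hm hk
      convert this using 1
      funext ω; simp
    have h1 := integral_logSumExp_add_le hI hmS hS (hξ k) (h0 k)
    have h2 := integral_logSumExp_add_sq_le hI hmS hS (hξ k) (h0 k) (hpos s)
    simp only [Finset.sum_insert hk, add_comm (ξ k _)]
    have hV : 0 ≤ ∑ i ∈ s, ∫ ω, ‖ξ i ω‖ ^ 2 ∂μ := Finset.sum_nonneg fun i _ => hv i
    have hvk := hv k
    set V := ∑ i ∈ s, ∫ ω, ‖ξ i ω‖ ^ 2 ∂μ
    set v := ∫ ω, ‖ξ k ω‖ ^ 2 ∂μ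
    refine ⟨by linarith, h2.trans ?_⟩
    -- With the first-moment bound inserted, the target exceeds what is available by `8 * v * (V +
    -- v)`.
    have := mul_le_mul_of_nonneg_left ih1 hvk
    nlinarith [mul_nonneg hvk hV, mul_nonneg hvk hvk]

end Moments

/-! ### Deterministic bounds: cones, optimality, coherence -/

section Deterministic

/-- Sup-norm control of a vector in a cone through its image under a matrix of small coherence. -/
lemma abs_le_of_coherence {ι : Type*} [Fintype ι] [DecidableEq ι] {Ψ : Matrix ι ι ℝ} {Δ : ι → ℝ}
    {J : Finset ι} {s : ℕ} {c₀ α ρ : ℝ} (hc₀ : 0 ≤ c₀) (hα : 1 < α) (hs : 1 ≤ s)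
    (hρ : 0 ≤ ρ) (hJ : J.card ≤ s) (hdiag : ∀ j, Ψ j j = 1)
    (hoff : ∀ i j, i ≠ j → |Ψ i j| ≤ 1 / (α * (1 + 2 * c₀) * s))
    (hcone : ∑ j ∈ Jᶜ, |Δ j| ≤ c₀ * ∑ j ∈ J, |Δ j|) (hΔ : ∀ j, |(Ψ *ᵥ Δ) j| ≤ ρ) (j : ι) :
    |Δ j| ≤ ρ * (1 + (1 + c₀) ^ 2 / ((1 + 2 * c₀) * (α - 1))) := by
  have hs0 : (0 : ℝ) < s := by exact_mod_cast hs
  set m := 1 / (α * (1 + 2 * c₀) * s) with hm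
  have hm0 : 0 ≤ m := by positivity
  have hms : α * (1 + 2 * c₀) * (s * m) = 1 := by rw [hm]; field_simp
  set N := ∑ j, |Δ j| with hN
  set NJ := ∑ j ∈ J, |Δ j| with hNJ
  have hNJ0 : 0 ≤ NJ := Finset.sum_nonneg fun _ _ => abs_nonneg _
  have hsplit : N ≤ (1 + c₀) * NJ := by
    rw [hN, ← Finset.sum_add_sum_compl J]; linarith
  have hpt : ∀ j, |Δ j| ≤ ρ + m * N := fun j => by
    have h1 : (Ψ *ᵥ Δ) j = Δ j + ∑ k ∈ Finset.univ.erase j, Ψ j k * Δ k := by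
      rw [Matrix.mulVec, dotProduct, ← Finset.add_sum_erase _ _ (Finset.mem_univ j), hdiag, one_mul]
    have h2 : |∑ k ∈ Finset.univ.erase j, Ψ j k * Δ k| ≤ m * N := by
      calc _ ≤ ∑ k ∈ Finset.univ.erase j, |Ψ j k * Δ k| := Finset.abs_sum_le_sum_abs _ _
        _ ≤ ∑ k ∈ Finset.univ.erase j, m * |Δ k| := Finset.sum_le_sum fun k hk => by
            rw [abs_mul]
            exact mul_le_mul_of_nonneg_right (hoff j k (Finset.ne_of_mem_erase hk).symm)
              (abs_nonneg _)
        _ ≤ ∑ k, m * |Δ k| := Finset.sum_le_sum_of_subset_of_nonneg (Finset.erase_subset _ _)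
            fun k _ _ => mul_nonneg hm0 (abs_nonneg _)
        _ = m * N := by rw [Finset.mul_sum]
    have h3 := hΔ j
    rw [h1] at h3
    rw [abs_le] at h2 h3 ⊢
    constructor <;> linarith
  have hN0 : 0 ≤ N := Finset.sum_nonneg fun _ _ => abs_nonneg _
  have hsum : NJ ≤ s * (ρ + m * N) := by
    calc NJ ≤ ∑ _j ∈ J, (ρ + m * N) := Finset.sum_le_sum fun j _ => hpt j
      _ = J.card * (ρ + m * N) := by rw [Finset.sum_const, nsmul_eq_mul]
      _ ≤ s * (ρ + m * N) := mul_le_mul_of_nonneg_right (by exact_mod_cast hJ) (by positivity)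
  set y := m * NJ with hy
  have hy0 : 0 ≤ y := mul_nonneg hm0 hNJ0
  have hmN : m * N ≤ (1 + c₀) * y := by
    calc m * N ≤ m * ((1 + c₀) * NJ) := mul_le_mul_of_nonneg_left hsplit hm0
      _ = _ := by rw [hy]; ring
  -- The bound on `NJ` is multiplied by `α * (1 + 2 * c₀) * m`, which cancels `s` through `hms`; the
  -- result can be solved for `y`.
  have hy1 : α * (1 + 2 * c₀) * y ≤ ρ + (1 + c₀) * y := by
    calc α * (1 + 2 * c₀) * y = α * (1 + 2 * c₀) * m * NJ := by rw [hy]; ring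
      _ ≤ α * (1 + 2 * c₀) * m * (s * (ρ + m * N)) :=
        mul_le_mul_of_nonneg_left hsum (by positivity)
      _ = (α * (1 + 2 * c₀) * (s * m)) * (ρ + m * N) := by ring
      _ ≤ ρ + (1 + c₀) * y := by rw [hms]; linarith
  have hden : 0 < (1 + 2 * c₀) * (α - 1) := mul_pos (by linarith) (by linarith)
  have hfin : (1 + c₀) * y ≤ ρ * ((1 + c₀) ^ 2 / ((1 + 2 * c₀) * (α - 1))) := by
    rw [mul_div_assoc', le_div_iff₀ hden]
    -- Here `α(1 + 2c₀) - (1 + c₀) = (1 + 2c₀)(α - 1) + c₀`, so `ρ` alone would do on the right; the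
    -- factor `1 + c₀` is slack matching the stated constant.
    have h1 : (1 + 2 * c₀) * (α - 1) * y ≤ ρ * (1 + c₀) := by
      nlinarith [mul_nonneg hc₀ hy0, mul_nonneg hρ hc₀]
    nlinarith [mul_le_mul_of_nonneg_left h1 (show 0 ≤ 1 + c₀ by linarith)]
  have := hpt j
  linarith

/-- If `θ = 0` off `J`, adding `Δ` increases the `ℓ₁`-norm by at least `|Δ_{Jᶜ}|₁ - |Δ_J|₁`. -/
lemma sum_abs_compl_sub_le {ι : Type*} [Fintype ι] [DecidableEq ι] {θ Δ : ι → ℝ} {J : Finset ι}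
    (hθ : ∀ j ∉ J, θ j = 0) :
    ∑ j ∈ Jᶜ, |Δ j| - ∑ j ∈ J, |Δ j| ≤ ∑ j, |θ j + Δ j| - ∑ j, |θ j| := by
  rw [← Finset.sum_add_sum_compl J fun j => |θ j + Δ j|, ← Finset.sum_add_sum_compl J fun j => |θ j|]
  have h1 : ∑ j ∈ Jᶜ, |θ j + Δ j| = ∑ j ∈ Jᶜ, |Δ j| := Finset.sum_congr rfl fun j hj => by
    rw [hθ j (Finset.mem_compl.1 hj), zero_add]
  have h2 : ∑ j ∈ Jᶜ, |θ j| = 0 := Finset.sum_eq_zero fun j hj => by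
    rw [hθ j (Finset.mem_compl.1 hj), abs_zero]
  have h3 : ∑ j ∈ J, |θ j| - ∑ j ∈ J, |Δ j| ≤ ∑ j ∈ J, |θ j + Δ j| := by
    rw [← Finset.sum_sub_distrib]
    exact Finset.sum_le_sum fun j _ => by
      have := abs_sub_abs_le_abs_sub (θ j) (-Δ j)
      rwa [abs_neg, sub_neg_eq_add] at this
  linarith

variable {n M : ℕ} {X : Matrix (Fin n) (Fin M) ℝ} {r : ℝ} {y : Fin n → ℝ}

/-- The vector `(1/n) Xᵀ (y - Xθ)` of correlations of the columns of `X` with the residual. -/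
noncomputable def residualCorr (X : Matrix (Fin n) (Fin M) ℝ) (y : Fin n → ℝ) (θ : Fin M → ℝ) :
    Fin M → ℝ :=
  fun j => (1 / (n : ℝ)) * (Xᵀ *ᵥ (y - X *ᵥ θ)) j

lemma gramMatrix_mulVec_sub (θ θ' : Fin M → ℝ) :
    gramMatrix X *ᵥ (θ' - θ) = residualCorr X y θ - residualCorr X y θ' := by
  funext j
  simp only [gramMatrix, residualCorr, Matrix.smul_mulVec, ← Matrix.mulVec_mulVec, Pi.sub_apply,
    Matrix.mulVec_sub, Pi.smul_apply, smul_eq_mul]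
  ring

lemma lassoObjective_add (θ h : Fin M → ℝ) :
    lassoObjective X r y (θ + h) = lassoObjective X r y θ - 2 * (residualCorr X y θ ⬝ᵥ h) +
      (1 / (n : ℝ)) * ∑ i, (X *ᵥ h) i ^ 2 + 2 * r * (∑ j, |θ j + h j| - ∑ j, |θ j|) := by
  have h1 : residualCorr X y θ ⬝ᵥ h = (1 / (n : ℝ)) * ∑ i, (y i - (X *ᵥ θ) i) * (X *ᵥ h) i := by
    have : residualCorr X y θ = (1 / (n : ℝ)) • (Xᵀ *ᵥ (y - X *ᵥ θ)) := rfl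
    rw [this, smul_dotProduct, Matrix.mulVec_transpose, ← Matrix.dotProduct_mulVec]
    rfl
  have h2 : ∑ i, (y i - (X *ᵥ (θ + h)) i) ^ 2 = ∑ i, (y i - (X *ᵥ θ) i) ^ 2 -
      2 * ∑ i, (y i - (X *ᵥ θ) i) * (X *ᵥ h) i + ∑ i, (X *ᵥ h) i ^ 2 := by
    rw [Finset.mul_sum, ← Finset.sum_sub_distrib, ← Finset.sum_add_distrib]
    refine Finset.sum_congr rfl fun i _ => ?_
    rw [Matrix.mulVec_add, Pi.add_apply]; ring
  rw [h1, lassoObjective, lassoObjective, h2]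
  simp only [Pi.add_apply]
  ring

/-- First-order condition for the Lasso: its solutions satisfy the Dantzig constraint. -/
lemma abs_residualCorr_le_of_mem_lassoSolutions (hr : 0 ≤ r)
    (hdiag : ∀ j, gramMatrix X j j = 1) {θ : Fin M → ℝ} (hθ : θ ∈ lassoSolutions X r y) (j : Fin M) : |residualCorr X y θ j| ≤ r := by
  set g := residualCorr X y θ j with hg
  -- Minimality is tested along coordinate `j`; the unit diagonal makes the quadratic term exactly
  -- `t ^ 2`. The values of `t` used below are the soft-thresholded `g`.
  have key : ∀ t : ℝ, 2 * (g * t) ≤ t ^ 2 + 2 * |t| * r := fun t => by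
    have h1 : lassoObjective X r y θ ≤ lassoObjective X r y (θ + Pi.single j t) :=
      hθ (Set.mem_univ _)
    have h2 : (1 / (n : ℝ)) * ∑ i, (X *ᵥ Pi.single j t) i ^ 2 = t ^ 2 := by
      have h3 := hdiag j
      simp only [gramMatrix, Matrix.smul_apply, Matrix.mul_apply, Matrix.transpose_apply,
        smul_eq_mul] at h3
      calc _ = ((1 / (n : ℝ)) * ∑ i, X i j * X i j) * t ^ 2 := by
            rw [mul_assoc, Finset.sum_mul]
            congr 1
            refine Finset.sum_congr rfl fun i _ => ?_
            simp [Matrix.mulVec_single]; ring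
        _ = t ^ 2 := by rw [h3, one_mul]
    have h4 : ∑ k, |θ k + (Pi.single j t : Fin M → ℝ) k| - ∑ k, |θ k| ≤ |t| := by
      have : ∑ k, |(Pi.single j t : Fin M → ℝ) k| = |t| := by
        rw [Finset.sum_eq_single j] <;> simp +contextual
      rw [← this, sub_le_iff_le_add', ← Finset.sum_add_distrib]
      exact Finset.sum_le_sum fun k _ => abs_add_le _ _
    rw [lassoObjective_add, h2, dotProduct_single] at h1
    nlinarith [mul_le_mul_of_nonneg_left h4 hr]
  by_contra! hlt
  rcases abs_cases g with ⟨hg', _⟩ | ⟨hg', _⟩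
  · have h1 := key (g - r)
    rw [abs_of_pos (by linarith)] at h1
    nlinarith
  · have h1 := key (g + r)
    rw [abs_of_neg (by linarith)] at h1
    nlinarith

/-- Noise costs at most `r |Δ|₁`, while the penalty gains at least `2r (|Δ_{Jᶜ}|₁ - |Δ_J|₁)`;
comparing the two produces the 3. -/
lemma sum_abs_compl_le_of_mem_lassoSolutions {θs θ : Fin M → ℝ} {J : Finset (Fin M)} (hr : 0 < r)
    (hJ : ∀ j ∉ J, θs j = 0) (hnoise : ∀ j, |residualCorr X y θs j| ≤ r / 2)
    (hθ : θ ∈ lassoSolutions X r y) :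
    ∑ j ∈ Jᶜ, |(θ - θs) j| ≤ 3 * ∑ j ∈ J, |(θ - θs) j| := by
  have h1 : lassoObjective X r y θ ≤ lassoObjective X r y θs := hθ (Set.mem_univ _)
  have h2 := lassoObjective_add (X := X) (r := r) (y := y) θs (θ - θs)
  rw [add_sub_cancel] at h2
  have h3 := sum_abs_compl_sub_le (Δ := θ - θs) hJ
  have h4 : residualCorr X y θs ⬝ᵥ (θ - θs) ≤ r / 2 * ∑ j, |(θ - θs) j| := by
    rw [dotProduct, Finset.mul_sum]
    refine Finset.sum_le_sum fun j _ => (le_abs_self _).trans ?_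
    rw [abs_mul]
    exact mul_le_mul_of_nonneg_right (hnoise j) (abs_nonneg _)
  have h5 : 0 ≤ (1 / (n : ℝ)) * ∑ i, (X *ᵥ (θ - θs)) i ^ 2 := by positivity
  rw [← Finset.sum_add_sum_compl J fun j => |(θ - θs) j|] at h4
  have h6 := mul_le_mul_of_nonneg_left h3 hr.le
  refine le_of_mul_le_mul_left ?_ hr
  linarith

/-- Feasibility of the target gives `|θ|₁ ≤ |θs|₁`, with no noise term to absorb; hence the constant
1. -/
lemma sum_abs_compl_le_of_mem_dantzigSolutions {θs θ : Fin M → ℝ} {J : Finset (Fin M)}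
    (hJ : ∀ j ∉ J, θs j = 0) (hθs : θs ∈ dantzigFeasible X r y)
    (hθ : θ ∈ dantzigSolutions X r y) :
    ∑ j ∈ Jᶜ, |(θ - θs) j| ≤ 1 * ∑ j ∈ J, |(θ - θs) j| := by
  have h1 : ∑ j, |θ j| ≤ ∑ j, |θs j| := hθ.2 hθs
  have h3 := sum_abs_compl_sub_le (Δ := θ - θs) hJ
  simp only [Pi.sub_apply, add_sub_cancel] at h3 ⊢
  linarith

lemma rateConst_nonneg {c₀ α : ℝ} (hc₀ : 0 ≤ c₀) (hα : 1 < α) : 0 ≤ rateConst c₀ α := by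
  have := sub_pos.2 hα
  unfold rateConst; positivity

/-- The sup-norm error bound, from the cone condition and the Dantzig constraint. -/
lemma norm_sub_le_of_mutualCoherence {c₀ α : ℝ} {s : ℕ} {θs θ : Fin M → ℝ} {J : Finset (Fin M)}
    (hc₀ : 0 ≤ c₀) (hα : 1 < α) (hs : 1 ≤ s) (hr : 0 ≤ r) (hX : MutualCoherence X c₀ α s)
    (hJs : J.card ≤ s) (hnoise : ∀ j, |residualCorr X y θs j| ≤ r / 2)
    (hcorr : ∀ j, |residualCorr X y θ j| ≤ r)
    (hcone : ∑ j ∈ Jᶜ, |(θ - θs) j| ≤ c₀ * ∑ j ∈ J, |(θ - θs) j|) :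
    ‖θ - θs‖ ≤ rateConst c₀ α * r := by
  refine (pi_norm_le_iff_of_nonneg (mul_nonneg (rateConst_nonneg hc₀ hα) hr)).2 fun j => ?_
  have h := abs_le_of_coherence (ρ := 3 / 2 * r) hc₀ hα hs (by positivity) hJs hX.diag hX.offDiag
    hcone (fun j => by
      rw [gramMatrix_mulVec_sub (y := y), Pi.sub_apply]
      have := abs_sub (residualCorr X y θs j) (residualCorr X y θ j)
      linarith [hnoise j, hcorr j]) j
  refine h.trans_eq ?_
  unfold rateConst; ring

variable {α : ℝ} {s : ℕ} {θs θ : Fin M → ℝ}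

lemma exists_support_of_numNonzero_le (hθs : numNonzero θs ≤ s) :
    ∃ J : Finset (Fin M), J.card ≤ s ∧ ∀ j ∉ J, θs j = 0 := by
  classical
  refine ⟨Finset.univ.filter fun j => θs j ≠ 0, ?_, fun j hj => by simpa using hj⟩
  rw [← Set.ncard_coe_finset]
  simpa [numNonzero] using hθs

lemma norm_sub_le_of_mem_lassoSolutions (hα : 1 < α) (hs : 1 ≤ s) (hr : 0 < r)
    (hX : MutualCoherence X 3 α s) (hθs : numNonzero θs ≤ s)
    (hnoise : ∀ j, |residualCorr X y θs j| ≤ r / 2) (hθ : θ ∈ lassoSolutions X r y) :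
    ‖θ - θs‖ ≤ rateConst 3 α * r := by
  obtain ⟨J, hJs, hJ⟩ := exists_support_of_numNonzero_le hθs
  exact norm_sub_le_of_mutualCoherence (by norm_num) hα hs hr.le hX hJs hnoise
    (abs_residualCorr_le_of_mem_lassoSolutions hr.le hX.diag hθ)
    (sum_abs_compl_le_of_mem_lassoSolutions hr hJ hnoise hθ)

lemma norm_sub_le_of_mem_dantzigSolutions (hα : 1 < α) (hs : 1 ≤ s) (hr : 0 < r)
    (hX : MutualCoherence X 1 α s) (hθs : numNonzero θs ≤ s)
    (hnoise : ∀ j, |residualCorr X y θs j| ≤ r / 2) (hθ : θ ∈ dantzigSolutions X r y) :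
    ‖θ - θs‖ ≤ rateConst 1 α * r := by
  obtain ⟨J, hJs, hJ⟩ := exists_support_of_numNonzero_le hθs
  have hfeas : θs ∈ dantzigFeasible X r y := fun j => (hnoise j).trans (by linarith)
  exact norm_sub_le_of_mutualCoherence zero_le_one hα hs hr.le hX hJs hnoise hθ.1
    (sum_abs_compl_le_of_mem_dantzigSolutions hJ hfeas hθ)

/-- This lets the Dantzig bound with `c₀ = 1` be used under the Lasso assumption `c₀ = 3`. -/
lemma MutualCoherence.anti {c₀ c₁ : ℝ} (hX : MutualCoherence X c₁ α s) (hc₀ : 0 ≤ c₀)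
    (h : c₀ ≤ c₁) (hα : 1 < α) (hs : 1 ≤ s) : MutualCoherence X c₀ α s where
  diag := hX.diag
  offDiag i j hij := by
    have hs0 : (0 : ℝ) < s := by exact_mod_cast hs
    refine (hX.offDiag i j hij).trans (one_div_le_one_div_of_le (by positivity) ?_)
    gcongr

lemma MutualCoherence.pos {c₀ : ℝ} (hX : MutualCoherence X c₀ α s) (j : Fin M) : 0 < n := by
  rcases Nat.eq_zero_or_pos n with rfl | h
  · have := hX.diag j
    simp [gramMatrix] at this
  · exact h

end Deterministic

/-! ### Tail bound for the noise correlations -/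

section Noise

variable {Ω : Type*} [MeasurableSpace Ω] {μ : Measure Ω} [IsProbabilityMeasure μ] {n M : ℕ}

/-- Tail bound for `logSumExp` of a sum of independent centred vectors, whose total variance is of
the order of the logarithm of the dimension. -/
lemma measureReal_le_logSumExp_sum_le {ι κ : Type*} [Fintype ι] [Fintype κ] [Nonempty κ]
    {ξ : ι → Ω → κ → ℝ} {l t : ℝ} (hm : ∀ i, Measurable (ξ i)) (hind : iIndepFun ξ μ)
    (hξ : ∀ i, MemLp (ξ i) 2 μ) (h0 : ∀ i j, ∫ ω, ξ i ω j ∂μ = 0)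
    (hpos : ∀ (s : Finset ι) ω, 0 ≤ logSumExp (∑ i ∈ s, ξ i ω)) (hl : 1 / 2 ≤ l) (ht : 0 < t)
    (hcard : Real.log (Fintype.card κ) ≤ 2 * l) (hV : ∑ i, ∫ ω, ‖ξ i ω‖ ^ 2 ∂μ ≤ l) :
    μ.real {ω | t ≤ logSumExp (∑ i, ξ i ω)} ≤ 22 * l ^ 2 / t ^ 2 := by
  have hmom := (integral_logSumExp_sum_le hm hind hξ h0 hpos Finset.univ).2
  have hV0 : 0 ≤ ∑ i, ∫ ω, ‖ξ i ω‖ ^ 2 ∂μ :=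
    Finset.sum_nonneg fun i _ => integral_nonneg fun ω => sq_nonneg _
  have hcard0 : 0 ≤ Real.log (Fintype.card κ) := Real.log_natCast_nonneg _
  generalize (∑ i, ∫ ω, ‖ξ i ω‖ ^ 2 ∂μ) = V at hmom hV hV0
  generalize Real.log (Fintype.card κ) = K at hmom hcard hcard0
  have hmom' : ∫ ω, logSumExp (∑ i, ξ i ω) ^ 2 ∂μ ≤ 22 * l ^ 2 := by
    refine hmom.trans ?_
    have h1 : K ^ 2 ≤ (2 * l) ^ 2 := pow_le_pow_left₀ hcard0 hcard 2
    have h2 : V * (1 + 4 * (K + 2 * V)) ≤ l * (1 + 4 * (2 * l + 2 * l)) := by gcongr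
    -- The total is `4l² + 16l² + l`, and `l ≤ 2l²` because `l ≥ 1/2`.
    nlinarith
  have hS : MemLp (fun ω => ∑ i, ξ i ω) 2 μ := memLp_finsetSum _ fun i _ => hξ i
  have hint : Integrable (fun ω => logSumExp (∑ i, ξ i ω) ^ 2) μ :=
    (memLp_logSumExp hS).integrable_sq
  have hcheb := mul_meas_ge_le_integral_of_nonneg (ae_of_all _ fun ω => sq_nonneg _) hint (t ^ 2)
  have hsub : {ω | t ≤ logSumExp (∑ i, ξ i ω)} ⊆ {ω | t ^ 2 ≤ logSumExp (∑ i, ξ i ω) ^ 2} :=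
    fun ω hω => pow_le_pow_left₀ ht.le hω 2
  rw [le_div_iff₀' (by positivity)]
  exact (mul_le_mul_of_nonneg_left (measureReal_mono hsub) (by positivity)).trans
    (hcheb.trans hmom')

/-- The vector `x` scaled by `β`, followed by its negative: its largest coordinate is `β |x|_∞`. -/
def signedScale (β : ℝ) (x : Fin M → ℝ) : Fin M ⊕ Fin M → ℝ :=
  Sum.elim (fun j => β * x j) fun j => -(β * x j)

lemma norm_signedScale_sq_le {β b : ℝ} {x : Fin M → ℝ} (hβ : 0 ≤ β) (hb : 0 ≤ b)
    (h : ∀ j, |x j| ^ 2 ≤ b) : ‖signedScale β x‖ ^ 2 ≤ β ^ 2 * b := by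
  have hx : ∀ j, |β * x j| ≤ β * √b := fun j => by
    rw [abs_mul, abs_of_nonneg hβ]
    exact mul_le_mul_of_nonneg_left (Real.le_sqrt_of_sq_le (h j)) hβ
  have : ‖signedScale β x‖ ≤ β * √b := by
    refine (pi_norm_le_iff_of_nonneg (by positivity)).2 fun k => ?_
    cases k with
    | inl j => exact hx j
    | inr j => simpa [signedScale] using hx j
  calc ‖signedScale β x‖ ^ 2 ≤ (β * √b) ^ 2 := pow_le_pow_left₀ (norm_nonneg _) this 2
    _ = β ^ 2 * b := by rw [mul_pow, Real.sq_sqrt hb]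

lemma sum_smul_signedScale {ι : Type*} (s : Finset ι) (β : ℝ) (w : ι → ℝ) (x : ι → Fin M → ℝ) :
    ∑ i ∈ s, w i • signedScale β (x i) = signedScale β (∑ i ∈ s, w i • x i) := by
  funext k
  cases k <;>
  · simp only [signedScale, Finset.sum_apply, Pi.smul_apply, Sum.elim_inl, Sum.elim_inr,
      smul_eq_mul, Finset.mul_sum, ← Finset.sum_neg_distrib]
    exact Finset.sum_congr rfl fun i _ => by ring

/-- Carrying both signs turns the smooth maximum into a bound on absolute values, and also makes it
nonnegative, as the second-moment recursion requires. -/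
lemma mul_abs_le_logSumExp_signedScale {β : ℝ} (hβ : 0 ≤ β) (x : Fin M → ℝ) (j : Fin M) :
    β * |x j| ≤ logSumExp (signedScale β x) := by
  have : Nonempty (Fin M) := ⟨j⟩
  have h1 := le_logSumExp (signedScale β x) (Sum.inl j)
  have h2 := le_logSumExp (signedScale β x) (Sum.inr j)
  have h3 : signedScale β x (Sum.inl j) = β * x j := rfl
  have h4 : signedScale β x (Sum.inr j) = -(β * x j) := rfl
  rw [h3] at h1
  rw [h4] at h2
  rw [← abs_of_nonneg hβ, ← abs_mul, abs_of_nonneg hβ]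
  exact abs_le.2 ⟨by linarith, h1⟩

/-- Tail bound for the maximum of `M` linear combinations of independent centred variables, with
logarithmic dependence on `M`. Here `B i` bounds the squared coefficients of `W i`, and `β` is a
scale at which the total variance is at most `log M`. -/
lemma measureReal_exists_lt_abs_sum_le (hM : 2 ≤ M) (x : Fin n → Fin M → ℝ)
    {W : Fin n → Ω → ℝ} {σ β τ : ℝ} {B : Fin n → ℝ} (hβ : 0 < β) (hτ : 0 < τ)
    (hW : ∀ i, Measurable (W i)) (hind : iIndepFun W μ) (hL2 : ∀ i, MemLp (W i) 2 μ)
    (h0 : ∀ i, ∫ ω, W i ω ∂μ = 0) (hσ : ∀ i, ∫ ω, W i ω ^ 2 ∂μ ≤ σ ^ 2)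
    (hB : ∀ i j, |x i j| ^ 2 ≤ B i) (hβB : β ^ 2 * σ ^ 2 * ∑ i, B i ≤ Real.log M) :
    μ.real {ω | ∃ j, τ < |∑ i, x i j * W i ω|} ≤ 22 * Real.log M ^ 2 / (β * τ) ^ 2 := by
  have : Nonempty (Fin M) := ⟨⟨0, by omega⟩⟩
  have hB0 : ∀ i, 0 ≤ B i := fun i => (sq_nonneg _).trans (hB i (Classical.arbitrary _))
  have ha : ∀ i, ‖signedScale β (x i)‖ ^ 2 ≤ β ^ 2 * B i := fun i =>
    norm_signedScale_sq_le hβ.le (hB0 i) (hB i)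
  have hmv : ∀ i, Measurable fun w : ℝ => w • signedScale β (x i) := fun i =>
    measurable_id.smul_const _
  have hξm : ∀ i, Measurable fun ω => W i ω • signedScale β (x i) := fun i => (hmv i).comp (hW i)
  have hξL2 : ∀ i, MemLp (fun ω => W i ω • signedScale β (x i)) 2 μ := fun i =>
    ((hL2 i).norm.mul_const ‖signedScale β (x i)‖).mono' (hξm i).aestronglyMeasurable
      (ae_of_all _ fun ω => (norm_smul _ _).le)
  have hξ0 : ∀ i k, ∫ ω, (W i ω • signedScale β (x i)) k ∂μ = 0 := fun i k => by
    simp only [Pi.smul_apply, smul_eq_mul]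
    rw [integral_mul_const, h0, zero_mul]
  have hpos : ∀ (s : Finset (Fin n)) ω,
      0 ≤ logSumExp (∑ i ∈ s, W i ω • signedScale β (x i)) := fun s ω => by
    rw [sum_smul_signedScale]
    exact (mul_nonneg hβ.le (abs_nonneg _)).trans
      (mul_abs_le_logSumExp_signedScale hβ.le _ (Classical.arbitrary _))
  have hV : ∑ i, ∫ ω, ‖W i ω • signedScale β (x i)‖ ^ 2 ∂μ ≤ Real.log M := by
    refine le_trans ?_ hβB
    rw [Finset.mul_sum]
    refine Finset.sum_le_sum fun i _ => ?_
    simp only [norm_smul, mul_pow, Real.norm_eq_abs, sq_abs]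
    rw [integral_mul_const]
    calc _ ≤ σ ^ 2 * (β ^ 2 * B i) := mul_le_mul (hσ i) (ha i) (sq_nonneg _) (sq_nonneg _)
      _ = _ := by ring
  have hM2 : (2 : ℝ) ≤ M := by exact_mod_cast hM
  have hl2 : Real.log 2 ≤ Real.log M := Real.log_le_log two_pos hM2
  have hcard : Real.log (Fintype.card (Fin M ⊕ Fin M)) ≤ 2 * Real.log M := by
    have : ((Fintype.card (Fin M ⊕ Fin M) : ℕ) : ℝ) = 2 * M := by
      simp [two_mul]
    rw [this, Real.log_mul two_ne_zero (by linarith)]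
    linarith
  refine le_trans (measureReal_mono ?_) (measureReal_le_logSumExp_sum_le hξm (hind.comp _ hmv) hξL2
    hξ0 hpos (by linarith [Real.log_two_gt_d9]) (mul_pos hβ hτ) hcard hV)
  rintro ω ⟨j, hj⟩
  have h1 := mul_abs_le_logSumExp_signedScale hβ.le (∑ i, W i ω • x i) j
  rw [← sum_smul_signedScale] at h1
  have h2 : (∑ i, W i ω • x i) j = ∑ i, x i j * W i ω := by
    rw [Finset.sum_apply]
    exact Finset.sum_congr rfl fun i _ => mul_comm _ _
  rw [h2] at h1
  exact (mul_le_mul_of_nonneg_left hj.le hβ.le).trans h1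

lemma tuning_pos {σ δ : ℝ} (hn : 0 < n) (hM : 2 ≤ M) (hσ : 0 < σ) : 0 < tuning n M σ δ := by
  have hl : 0 < Real.log M := Real.log_pos (by exact_mod_cast hM)
  have hn' : (0 : ℝ) < n := by exact_mod_cast hn
  unfold tuning; positivity

/-- With high probability the correlations of the noise with the columns of the design are at most
half of the tuning parameter. -/
lemma exists_event_abs_residualCorr_le {c' : ℝ} (hc' : 0 < c') (hn : 0 < n) (hM : 2 ≤ M)
    (X : Matrix (Fin n) (Fin M) ℝ) (θs : Fin M → ℝ) {W : Fin n → Ω → ℝ} {Y : Ω → Fin n → ℝ}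
    {σ δ : ℝ} (hσ : 0 < σ) (hY : ∀ ω, Y ω = X *ᵥ θs + fun i => W i ω)
    (hW : ∀ i, Measurable (W i)) (hind : iIndepFun W μ) (hL2 : ∀ i, MemLp (W i) 2 μ)
    (h0 : ∀ i, ∫ ω, W i ω ∂μ = 0) (hvar : ∀ i, ∫ ω, W i ω ^ 2 ∂μ ≤ σ ^ 2)
    (hX : (1 / (n : ℝ)) * ∑ i, (⨆ j, |X i j| ^ 2) ≤ c') :
    ∃ A : Set Ω, MeasurableSet A ∧ 1 - 88 * c' / Real.log M ^ δ ≤ μ.real A ∧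
      ∀ ω ∈ A, ∀ j, |residualCorr X (Y ω) θs j| ≤ tuning n M σ δ / 2 := by
  have hl : 0 < Real.log M := Real.log_pos (by exact_mod_cast hM)
  have hn' : (0 : ℝ) < n := by exact_mod_cast hn
  have hr := tuning_pos (δ := δ) hn hM hσ
  have hr2 : tuning n M σ δ ^ 2 = σ ^ 2 * (Real.log M * Real.log M ^ δ / n) := by
    rw [tuning, mul_pow, Real.sq_sqrt (by positivity), Real.rpow_add hl, Real.rpow_one]
  set r := tuning n M σ δ
  set l := Real.log M
  set E : Set Ω := {ω | ∃ j, n * r / 2 < |∑ i, X i j * W i ω|} with hE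
  have hEm : MeasurableSet E := by
    rw [hE, Set.ofPred_exists]
    refine MeasurableSet.iUnion fun j => measurableSet_lt measurable_const ?_
    exact (Finset.measurable_fun_sum _ fun i _ => (hW i).const_mul _).norm
  refine ⟨Eᶜ, hEm.compl, ?_, fun ω hω j => ?_⟩
  · rw [probReal_compl_eq_one_sub hEm]
    -- This `β` solves `β² σ² n c' = log M`, so the rescaled total variance is at most `log M`. In
    -- the tail bound, `88 = 22 * 4`, the 4 coming from the threshold `r / 2`.
    have hβ2 : √(l / (σ ^ 2 * n * c')) ^ 2 = l / (σ ^ 2 * n * c') :=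
      Real.sq_sqrt (by positivity)
    have hsum : ∑ i, (⨆ j, |X i j| ^ 2) ≤ n * c' := by
      rwa [one_div, inv_mul_le_iff₀ hn'] at hX
    have htail := measureReal_exists_lt_abs_sum_le (β := √(l / (σ ^ 2 * n * c')))
      (τ := n * r / 2) (B := fun i => ⨆ j, |X i j| ^ 2) hM X (by positivity) (by positivity) hW hind
      hL2 h0 hvar (fun i j => le_ciSup (f := fun j => |X i j| ^ 2) (Set.finite_range _).bddAbove j)
      (by
        rw [hβ2]
        refine (mul_le_mul_of_nonneg_left hsum (by positivity)).trans_eq ?_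
        field_simp
        rfl)
    have heq : 22 * l ^ 2 / (√(l / (σ ^ 2 * n * c')) * (n * r / 2)) ^ 2 = 88 * c' / l ^ δ := by
      have hlδ : 0 < l ^ δ := Real.rpow_pos_of_pos hl δ
      rw [mul_pow, hβ2, div_pow, mul_pow, hr2]
      field_simp
      norm_num
    rw [heq] at htail
    linarith
  · have hres : residualCorr X (Y ω) θs j = (1 / (n : ℝ)) * ∑ i, X i j * W i ω := by
      rw [residualCorr, hY, add_sub_cancel_left]
      rfl
    have hle : |∑ i, X i j * W i ω| ≤ n * r / 2 := not_lt.1 fun h => hω ⟨j, h⟩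
    rw [hres, abs_mul, abs_of_pos (by positivity), one_div, inv_mul_le_iff₀ hn']
    linarith

end Noise
/- The norm on `Fin M → ℝ` is the sup-norm. The constant `c₀` of the coherence assumption is `1` for
the Dantzig estimators and `3` for the Lasso estimators. "With probability at least `p`" means: on
a measurable event of probability at least `p`. -/
theorem theorem3 (c' : ℝ) (hc' : 0 < c') :
    ∃ c : ℝ, 0 < c ∧
      ∀ {Ω : Type*} [MeasurableSpace Ω] (μ : Measure Ω) [IsProbabilityMeasure μ]
        (n M : ℕ) (_ : 2 ≤ M) (X : Matrix (Fin n) (Fin M) ℝ) (θs : Fin M → ℝ)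
        (W : Fin n → Ω → ℝ) (Y : Ω → Fin n → ℝ) (σ δ α : ℝ) (s : ℕ),
        0 < σ → 0 < δ → 1 < α → 1 ≤ s →
        -- the linear regression model
        (∀ ω, Y ω = X *ᵥ θs + fun i => W i ω) →
        -- the noise
        (∀ i, Measurable (W i)) →
        iIndepFun W μ →
        (∀ i, MemLp (W i) 2 μ) →
        (∀ i, ∫ ω, W i ω ∂μ = 0) →
        (∀ i, ∫ ω, (W i ω) ^ 2 ∂μ ≤ σ ^ 2) →
        -- sparsity of the target vector
        numNonzero θs ≤ s →
        -- the assumption on the size of the design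
        (1 / (n : ℝ)) * ∑ i, (⨆ j, |X i j| ^ 2) ≤ c' →
        -- Dantzig estimators
        (MutualCoherence X 1 α s →
          ∃ A : Set Ω, MeasurableSet A ∧ 1 - c / Real.log M ^ δ ≤ μ.real A ∧
            ∀ ω ∈ A, ∀ θ ∈ dantzigSolutions X (tuning n M σ δ) (Y ω),
              ‖θ - θs‖ ≤ rateConst 1 α * tuning n M σ δ) ∧
        -- Lasso estimators, and Dantzig estimators simultaneously
        (MutualCoherence X 3 α s →
          ∃ A : Set Ω, MeasurableSet A ∧ 1 - c / Real.log M ^ δ ≤ μ.real A ∧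
            ∀ ω ∈ A,
              (∀ θ ∈ lassoSolutions X (tuning n M σ δ) (Y ω),
                ‖θ - θs‖ ≤ rateConst 3 α * tuning n M σ δ) ∧
              (∀ θ ∈ dantzigSolutions X (tuning n M σ δ) (Y ω),
                ‖θ - θs‖ ≤ rateConst 1 α * tuning n M σ δ)) := by
  refine ⟨88 * c', by positivity, ?_⟩
  intro Ω _ μ _ n M hM X θs W Y σ δ α s hσ hδ hα hs hY hW hind hL2 h0 hvar hsp hX
  have hevent := fun hn : 0 < n =>
    exists_event_abs_residualCorr_le (δ := δ) hc' hn hM X θs hσ hY hW hind hL2 h0 hvar hX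
  have hr := fun hn : 0 < n => tuning_pos (δ := δ) hn hM hσ
  constructor
  · intro hmc
    have hn := hmc.pos ⟨0, by omega⟩
    obtain ⟨A, hAm, hA, hAr⟩ := hevent hn
    exact ⟨A, hAm, hA, fun ω hω θ hθ =>
      norm_sub_le_of_mem_dantzigSolutions hα hs (hr hn) hmc hsp (hAr ω hω) hθ⟩
  · intro hmc
    have hn := hmc.pos ⟨0, by omega⟩
    obtain ⟨A, hAm, hA, hAr⟩ := hevent hn
    exact ⟨A, hAm, hA, fun ω hω => ⟨fun θ hθ =>
      norm_sub_le_of_mem_lassoSolutions hα hs (hr hn) hmc hsp (hAr ω hω) hθ, fun θ hθ =>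
      norm_sub_le_of_mem_dantzigSolutions hα hs (hr hn)
        (hmc.anti zero_le_one (by norm_num) hα hs) hsp (hAr ω hω) hθ⟩⟩
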